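/- **Setting.** Let $d\ge 1$, let $|\cdot|$ be any norm on $\mathbb{R}^d$, let $B(x,r)$ be the closed ball of centre $x$ and radius $r$ for this norm, and let $v_d$ be the Lebesgue measure of $B(0,1)$. Let $\mathbf{\Theta}$ be a measurable space and let $f:\mathbb{R}^d\times\mathbf{\Theta}\to\mathbb{R}$ be measurable. Let $\mu_X,\mu_{X'}$ be probability measures on $\mathbb{R}^d$ and $\mu_\Theta$ a probability measure on $\mathbf{\Theta}$. Let $X\sim\mu_X$, and, independently of $X$, let $(X'_j,\Theta_j)_{j\ge1}$ be i.i.d. with $X'_j\sim\mu_{X'}$ and $\Theta_j\sim\mu_\Theta$ independent. Put $Y'_j=f(X'_j,\Theta_j)$ and, for $\Theta\sim\mu_\Theta$, $r(x)=\mathbb{E}[f(x,\Theta)]$. For $1\le k\le m$ let $$\hat r^{(k)}_m(x)=\frac1k\sum_{l=1}^k Y'_{j^{(l)}(x)},$$ where $j^{(1)}(x),\dots,j^{(m)}(x)$ are the indices $1,\dots,m$ sorted by increasing distance $|x-X'_j|$, ties being broken by increasing index. **Assumptions.** 1. There is an integer $m_0\ge1$ with $\mathbb{E}[\min_{1\le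 j\le m_0}|X'_j|]<\infty$. 2. There is an open set $U\supset\mathrm{supp}(\mu_X)$ such that $\mu_{X'}(\cdot\cap U)$ has a density $p_{X'}$ with respect to the Lebesgue measure which is continuous and positive on $U$, and there are $\kappa\in(0,1]$ and $r_\kappa>0$ with $\mu_{X'}(B(x,r))\ge\kappa\,p_{X'}(x)\,v_d\,r^d$ for all $x\in U$ and $r\in[0,r_\kappa]$. 3. $\mathbb{E}\big[(1+|X|^2)\,p_{X'}(X)^{-2/d}\big]<\infty$. 4. For some $L\ge 0$, $|f(x,\theta)-f(y,\theta)|\le L|x-y|$ for all $x,y\in\mathbb{R}^d$ and $\theta\in\mathbf{\Theta}$. 5. For some $\sigma\ge0$ and all $x\in\mathrm{supp}(\mu_{X'})$, $f(x,\Theta)$ is square integrable and $\mathrm{Var}(f(x,\Theta))\le\sigma^2$. 6. $(k_m)_{m\ge1}$ is a nondecreasing sequence of positive integers with $k_m\sim m^{2/(d+2)}$ as $m\to\infty$ (hence $k_m/m\to0$). **Theorem ($L^2$ generalization error of the $k$-NN regression under covariate shift).** There is a constant $C\ge0$, depending only on $d$, the norm $|\cdot|$ and $L$, such that under these assumptions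 $$\limsup_{m\to\infty}\ m^{1/(d+2)}\,\mathbb{E}\Big[\big(r(X)-\hat r^{(k_m)}_m(X)\big)^2\Big]^{1/2}\ \le\ \sigma+C\,\mathbb{E}\Big[p_{X'}(X)^{-2/d}\Big]^{1/2}.$$ -/

import Mathlib

open MeasureTheory ProbabilityTheory Filter Topology Asymptotics
open scoped ENNReal NNReal

noncomputable section

/-- The strong support condition on the law `μ` of `X` and the law `μ'` of `X'`, on a
finite-dimensional normed space `E` with Lebesgue measure `vol`: the open set `U` contains the
support of `μ`, on `U` the measure `μ'` has the continuous positive density `p`, and the strong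
minimal mass condition holds on `U`. -/
structure StrongSupport {E : Type*} [NormedAddCommGroup E] [NormedSpace ℝ E] [MeasurableSpace E]
    (vol μ μ' : Measure E) (U : Set E) (p : E → ℝ) : Prop where
  isOpen : IsOpen U
  support_subset : μ.support ⊆ U
  density : μ'.restrict U = (vol.restrict U).withDensity (fun x => ENNReal.ofReal (p x))
  continuousOn : ContinuousOn p U
  pos : ∀ x ∈ U, 0 < p x
  minimal_mass : ∃ κ : ℝ, 0 < κ ∧ κ ≤ 1 ∧ ∃ rκ : ℝ, 0 < rκ ∧ ∀ x ∈ U, ∀ r : ℝ, 0 ≤ r → r ≤ rκ →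
    κ * p x * vol.real (Metric.closedBall 0 1) * r ^ Module.finrank ℝ E
      ≤ μ'.real (Metric.closedBall x r)

/-- The sampling model of regression under covariate shift: an evaluation point `X` of law `μ`, and,
independently of it, i.i.d. pairs `(X' j, Θ j)`, where `X' j` has law `μ'`, `Θ j` has law `ν`, and
`X' j`, `Θ j` are independent. -/
structure CovariateShiftModel {Ω E T : Type*} [MeasurableSpace Ω] [MeasurableSpace E]
    [MeasurableSpace T] (P : Measure Ω) (μ μ' : Measure E) (ν : Measure T)
    (X : Ω → E) (X' : ℕ → Ω → E) (Θ : ℕ → Ω → T) : Prop where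
  measurable_X : Measurable X
  measurable_X' : ∀ j, Measurable (X' j)
  measurable_Θ : ∀ j, Measurable (Θ j)
  law_X : P.map X = μ
  law_X' : ∀ j, P.map (X' j) = μ'
  law_Θ : ∀ j, P.map (Θ j) = ν
  indep_X'_Θ : ∀ j, IndepFun (X' j) (Θ j) P
  indep_sample : iIndepFun (fun j ω => (X' j ω, Θ j ω)) P
  indep_X_sample : IndepFun X (fun ω j => (X' j ω, Θ j ω)) P

/-- Index of the `(l + 1)`-th nearest neighbor of `x` among `xs 0, …, xs (m - 1)`: the indices are
sorted by increasing distance to `x`, and among equal distances by increasing index (this is the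
convention of `Tuple.sort`). -/
def nnIndex {E : Type*} [NormedAddCommGroup E] {m : ℕ} (xs : Fin m → E) (x : E) (l : Fin m) :
    Fin m :=
  Tuple.sort (fun j => ‖x - xs j‖) l

/-- The `k`-NN regression estimate at `x` from the training data `(xs j, ys j)`, `j < m`, where
`k ≤ m`: the mean of the `ys` attached to the `k` nearest neighbors of `x`. -/
def kNNRegressor {E : Type*} [NormedAddCommGroup E] {m : ℕ} (k : ℕ) (xs : Fin m → E)
    (ys : Fin m → ℝ) (x : E) : ℝ :=
  (1 / (k : ℝ)) * ∑ l : Fin m with l.val < k, ys (nnIndex xs x l)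

/-- The regression function `r x = 𝔼[f (x, Θ)]`, where `Θ` has law `ν`. -/
def regressionFunction {E T : Type*} [MeasurableSpace T] (f : E → T → ℝ) (ν : Measure T) (x : E) :
    ℝ :=
  ∫ θ, f x θ ∂ν

/-- The `L²` generalization error `𝔼[(r(X) - r̂(X))²]^(1/2)`, valued in `[0, ∞]`, of the `k`-NN
regression trained on the first `m` observations `(X' j, f (X' j, Θ j))`. -/
def l2GeneralizationError {Ω E T : Type*} [MeasurableSpace Ω] [NormedAddCommGroup E]
    [MeasurableSpace T] (P : Measure Ω) (f : E → T → ℝ) (ν : Measure T)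
    (X : Ω → E) (X' : ℕ → Ω → E) (Θ : ℕ → Ω → T) (m k : ℕ) : ℝ≥0∞ :=
  (∫⁻ ω, ENNReal.ofReal ((regressionFunction f ν (X ω)
      - kNNRegressor k (fun j : Fin m => X' j ω) (fun j : Fin m => f (X' j ω) (Θ j ω)) (X ω)) ^ 2)
    ∂P) ^ (1 / 2 : ℝ)

end

/-! Condition on the evaluation point `x` and on the inputs. The estimate is then a weighted sum of
independent responses, with weight `1/k` on the `k` nearest inputs, so its variance is at most
`σ²/k`. By the Lipschitz condition and Cauchy–Schwarz, its squared bias is at most `L²` times the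
mean of the `k` smallest squared distances.

To avoid order statistics, cut the sample into `k` disjoint blocks of `n = m / k` points. The
nearest points of the blocks are `k` distinct competitors, so the `k` smallest squared distances sum
to at most the sum of the block minima. Each block minimum has mean `nnSqDist μ' n x`, the integral
over `s` of `distTail μ' x s ^ n`. Hence the mean squared error is at most `σ²/k + L² 𝔼[nnSqDist μ'
n X]` (`l2GeneralizationError_le`).

If balls of radius `r ≤ r₀` around `x` have mass at least `a r^d`, small `s` contribute at most `(n
a)^(-2/d) Γ(2/d + 1)`. Large `s` contribute an exponentially small factor times `nnSqDist μ' n₀ x`,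
finite by the moment condition on the inputs (`nnSqDist_two_mul_le`).

This bound is used twice. With the minimal mass condition, whose radius is uniform, it dominates
`n^(2/d) nnSqDist μ' n X` by an integrable function, at the price of constants involving `κ`. With
continuity of the density, it bounds the pointwise limsup by a constant involving only `d` and the
unit ball. The reverse Fatou lemma combines the two, so `κ` disappears from the result
(`limsup_lintegral_nnSqDist_le`). Finally, `k ~ m^(2/(d+2))` makes `k^(-1/2)` and `n^(-1/d)` both of
order `m^(-1/(d+2))`. -/

/-! ### Sorting and nearest neighbors -/

/-- The sum of the `k` smallest values is at most the sum over any `k` distinct indices. -/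
lemma sum_le_sum_comp_embedding_of_monotone_comp {m k : ℕ} (hkm : k ≤ m) (u : Fin m → ℝ)
    (τ : Equiv.Perm (Fin m)) (hu : Monotone (u ∘ τ)) (e : Fin k ↪ Fin m) :
    ∑ l : Fin m with l.val < k, u (τ l) ≤ ∑ b, u (e b) := by
  classical
  -- The ranks, in sorted order, of the `k` chosen indices.
  set S : Finset (Fin m) := Finset.univ.map (e.trans τ.symm.toEmbedding) with hS
  have hcard : S.card = k := by simp [hS]
  have h1 : ∑ b, u (e b) = ∑ l ∈ S, u (τ l) := by simp [hS]
  have h2 : ∑ l ∈ S, u (τ l) = ∑ i : Fin k, u (τ (S.orderEmbOfFin hcard i)) := by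
    conv_lhs => rw [← Finset.image_orderEmbOfFin_univ S hcard]
    rw [Finset.sum_image (fun a _ b _ h => (S.orderEmbOfFin hcard).injective h)]
  have h3 : ∑ l : Fin m with l.val < k, u (τ l) = ∑ i : Fin k, u (τ (Fin.castLE hkm i)) := by
    symm
    refine Finset.sum_nbij (fun i => Fin.castLE hkm i) ?_ ?_ ?_ ?_
    · intro i _; simp
    · intro a _ b _ h; exact Fin.castLE_injective hkm h
    · intro l hl
      simp only [Finset.coe_filter, Finset.mem_univ, true_and, Set.mem_ofPred_eq] at hl
      exact ⟨⟨l, hl⟩, by simp, by ext; simp⟩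
    · intro i _; rfl
  rw [h1, h2, h3]
  refine Finset.sum_le_sum fun i _ => hu ?_
  -- In increasing enumeration, the `n`-th chosen rank (from `0`) is at least `n`, so monotonicity
  -- compares the sums term by term.
  have key : ∀ n : ℕ, ∀ h : n < k, n ≤ (S.orderEmbOfFin hcard ⟨n, h⟩).val := by
    intro n
    induction n with
    | zero => intro h; exact Nat.zero_le _
    | succ n ih =>
      intro h
      have := ih (by omega)
      have h' : S.orderEmbOfFin hcard ⟨n, by omega⟩ < S.orderEmbOfFin hcard ⟨n + 1, h⟩ :=
        (S.orderEmbOfFin hcard).strictMono (by simp)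
      have h'' : (S.orderEmbOfFin hcard ⟨n, by omega⟩).val
        < (S.orderEmbOfFin hcard ⟨n + 1, h⟩).val := h'
      omega
  exact key i i.2

lemma sum_sq_dist_nnIndex_le {E : Type*} [NormedAddCommGroup E] {m k : ℕ} (hkm : k ≤ m)
    (xs : Fin m → E) (x : E) (e : Fin k ↪ Fin m) :
    ∑ l : Fin m with l.val < k, ‖x - xs (nnIndex xs x l)‖ ^ 2 ≤ ∑ b, ‖x - xs (e b)‖ ^ 2 := by
  refine sum_le_sum_comp_embedding_of_monotone_comp hkm (fun j => ‖x - xs j‖ ^ 2) _ ?_ e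
  intro a b hab
  have := Tuple.monotone_sort (fun j => ‖x - xs j‖) hab
  simp only [Function.comp_apply] at this ⊢
  gcongr

/-- The `b`-th of `k` disjoint blocks of `m / k` indices below `m`. -/
def indexBlock (m k : ℕ) (b : Fin k) : Finset (Fin m) :=
  Finset.univ.filter fun j => j.val / (m / k) = b.val

lemma card_indexBlock {m k : ℕ} (hk : 1 ≤ k) (hkm : k ≤ m) (b : Fin k) :
    (indexBlock m k b).card = m / k := by
  have hn : 0 < m / k := Nat.div_pos hkm hk
  have hmul : m / k * k ≤ m := Nat.div_mul_le_self m k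
  have hb : (b.val + 1) * (m / k) ≤ m := by
    calc (b.val + 1) * (m / k) ≤ k * (m / k) := Nat.mul_le_mul_right _ b.2
      _ ≤ m := by rw [mul_comm]; exact hmul
  rw [← Finset.card_map (Fin.valEmbedding), show (indexBlock m k b).map Fin.valEmbedding
    = Finset.Ico (b.val * (m / k)) ((b.val + 1) * (m / k)) from ?_]
  · rw [Nat.card_Ico, add_mul, one_mul, Nat.add_sub_cancel_left]
  · ext a
    simp only [indexBlock, Finset.mem_map, Finset.mem_filter, Finset.mem_univ, true_and,
      Fin.valEmbedding_apply, Finset.mem_Ico]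
    constructor
    · rintro ⟨j, hj, rfl⟩
      rw [Nat.div_eq_iff hn] at hj
      constructor
      · omega
      · rw [add_mul]; omega
    · rintro ⟨h1, h2⟩
      refine ⟨⟨a, by omega⟩, ?_, rfl⟩
      rw [add_mul] at h2
      rw [Nat.div_eq_iff hn]
      constructor <;> simp only <;> omega

lemma indexBlock_nonempty {m k : ℕ} (hk : 1 ≤ k) (hkm : k ≤ m) (b : Fin k) :
    (indexBlock m k b).Nonempty := by
  rw [← Finset.card_pos, card_indexBlock hk hkm]
  exact Nat.div_pos hkm hk

/-- Disjointness of the blocks makes their minimizers `k` distinct indices, which cannot beat the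
`k` nearest neighbors. Block minima, unlike order statistics, have product tails. -/
lemma sum_sq_dist_nnIndex_le_sum_inf {E : Type*} [NormedAddCommGroup E] {m k : ℕ} (hk : 1 ≤ k)
    (hkm : k ≤ m) (xs : Fin m → E) (x : E) :
    ∑ l : Fin m with l.val < k, ‖x - xs (nnIndex xs x l)‖ ^ 2
      ≤ ∑ b, (indexBlock m k b).inf' (indexBlock_nonempty hk hkm b) fun j => ‖x - xs j‖ ^ 2 := by
  choose e he he' using fun b => Finset.exists_mem_eq_inf' (indexBlock_nonempty hk hkm b)
    (fun j => ‖x - xs j‖ ^ 2)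
  have hinj : Function.Injective e := by
    intro a b hab
    have ha := he a
    have hb := he b
    simp only [indexBlock, Finset.mem_filter, Finset.mem_univ, true_and] at ha hb
    ext
    rw [← ha, ← hb, hab]
  refine (sum_sq_dist_nnIndex_le hkm xs x ⟨e, hinj⟩).trans (le_of_eq ?_)
  exact Finset.sum_congr rfl fun b _ => (he' b).symm

/-! ### Bias and variance of the estimate for fixed inputs -/

lemma card_filter_val_lt {m k : ℕ} (hkm : k ≤ m) :
    (Finset.univ.filter fun l : Fin m => l.val < k).card = k := by
  rw [Fin.card_filter_val_lt, min_eq_right hkm]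

/-- Summing over sample indices rather than ranks puts all the randomness of the neighbor selection
into weights that depend on the inputs alone. -/
lemma kNNRegressor_eq_sum {E : Type*} [NormedAddCommGroup E] {m : ℕ} (k : ℕ) (xs : Fin m → E)
    (ys : Fin m → ℝ) (x : E) :
    kNNRegressor k xs ys x = ∑ j : Fin m,
      (if ((Tuple.sort fun j => ‖x - xs j‖).symm j).val < k then 1 / (k : ℝ) else 0) * ys j := by
  rw [kNNRegressor, Finset.mul_sum, Finset.sum_filter]
  symm
  rw [← Equiv.sum_comp (Tuple.sort fun j => ‖x - xs j‖)]
  refine Finset.sum_congr rfl fun l _ => ?_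
  simp [nnIndex]

/-- The difference of two sections of `f` is bounded, so integrability at one point of the support
of `μ'` spreads to the whole space. -/
lemma integrable_of_lipschitz_of_integrable {E T : Type*} [NormedAddCommGroup E]
    [MeasurableSpace T] {ν : Measure T} [IsFiniteMeasure ν] {f : E → T → ℝ} {L : ℝ≥0}
    (hmeas : ∀ x, Measurable (f x)) (hf : ∀ θ, LipschitzWith L fun x => f x θ) {y : E}
    (hy : Integrable (f y) ν) (x : E) : Integrable (f x) ν := by
  have h : Integrable (fun θ => f x θ - f y θ) ν := by
    refine Integrable.of_bound ((hmeas x).sub (hmeas y)).aestronglyMeasurable (L * ‖x - y‖) ?_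
    exact ae_of_all _ fun θ => by simpa [dist_eq_norm] using (hf θ).dist_le_mul x y
  refine (h.add hy).congr (ae_of_all _ fun θ => ?_)
  simp

lemma abs_regressionFunction_sub_le {E T : Type*} [NormedAddCommGroup E]
    [MeasurableSpace T] {ν : Measure T} [IsProbabilityMeasure ν] {f : E → T → ℝ} {L : ℝ≥0}
    (hf : ∀ θ, LipschitzWith L fun x => f x θ) (hint : ∀ x, Integrable (f x) ν) (x y : E) :
    |regressionFunction f ν x - regressionFunction f ν y| ≤ L * ‖x - y‖ := by
  rw [regressionFunction, regressionFunction, ← integral_sub (hint x) (hint y), ← Real.norm_eq_abs]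
  refine (norm_integral_le_of_norm_le_const (C := L * ‖x - y‖) ?_).trans (by simp)
  exact ae_of_all _ fun θ => by simpa [dist_eq_norm] using (hf θ).dist_le_mul x y

lemma lintegral_sq_sub_eq {W : Type*} [MeasurableSpace W] {ρ : Measure W} [IsProbabilityMeasure ρ]
    {S : W → ℝ} (hS : MemLp S 2 ρ) (a : ℝ) :
    ∫⁻ w, ENNReal.ofReal ((a - S w) ^ 2) ∂ρ
      = ENNReal.ofReal ((a - ∫ w, S w ∂ρ) ^ 2 + Var[S; ρ]) := by
  have hD : MemLp (fun w => a - S w) 2 ρ := (memLp_const a).sub hS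
  rw [← ofReal_integral_eq_lintegral_ofReal hD.integrable_sq (ae_of_all _ fun w => sq_nonneg _)]
  congr 1
  have h1 := variance_eq_sub hD
  have h2 : Var[fun w => a - S w; ρ] = Var[S; ρ] := variance_const_sub hS.aestronglyMeasurable a
  have h3 : ∫ w, (a - S w) ∂ρ = a - ∫ w, S w ∂ρ := by
    rw [integral_sub (integrable_const a) (hS.integrable (by norm_num))]; simp
  rw [h2, h3] at h1
  simp only [Pi.pow_apply] at h1
  linarith

/-- The conditional mean squared error of the estimate at `x`, given the inputs `xs`. -/
lemma lintegral_sq_kNNRegressor_le {E T : Type*} [NormedAddCommGroup E]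
    [MeasurableSpace T] {ν : Measure T} [IsProbabilityMeasure ν] {f : E → T → ℝ} {L : ℝ≥0}
    (hf : ∀ θ, LipschitzWith L fun x => f x θ) (hint : ∀ x, Integrable (f x) ν) {σ : ℝ}
    {m k : ℕ} (hk : 1 ≤ k) (hkm : k ≤ m) (xs : Fin m → E) (x : E)
    (hmem : ∀ j, MemLp (f (xs j)) 2 ν) (hvar : ∀ j, Var[f (xs j); ν] ≤ σ ^ 2) :
    ∫⁻ θ, ENNReal.ofReal ((regressionFunction f ν x
        - kNNRegressor k xs (fun j => f (xs j) (θ j)) x) ^ 2) ∂(Measure.pi fun _ : Fin m => ν)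
      ≤ ENNReal.ofReal (σ ^ 2 / k + (L : ℝ) ^ 2 / k * ∑ b, (indexBlock m k b).inf'
          (indexBlock_nonempty hk hkm b) fun j => ‖x - xs j‖ ^ 2) := by
  set τ := Tuple.sort fun j => ‖x - xs j‖ with hτ
  set w : Fin m → ℝ := fun j => if (τ.symm j).val < k then 1 / (k : ℝ) else 0 with hw
  have hk0 : (0 : ℝ) < k := by exact_mod_cast hk
  have hZ : ∀ j, MemLp (fun t => w j * f (xs j) t) 2 ν := fun j => (hmem j).const_mul _
  have hS : MemLp (∑ j, fun θ : Fin m → T => w j * f (xs j) (θ j)) 2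
      (Measure.pi fun _ : Fin m => ν) := by
    refine memLp_finsetSum' _ fun j _ => ?_
    exact (hZ j).comp_measurePreserving (measurePreserving_eval (fun _ : Fin m => ν) j)
  have hSeq : ∀ θ : Fin m → T, kNNRegressor k xs (fun j => f (xs j) (θ j)) x
      = (∑ j, fun θ : Fin m → T => w j * f (xs j) (θ j)) θ := by
    intro θ
    rw [kNNRegressor_eq_sum, Finset.sum_apply]
  simp_rw [hSeq]
  rw [lintegral_sq_sub_eq hS]
  have hsumw : ∑ j, w j = 1 := by
    rw [← Equiv.sum_comp τ]
    simp only [hw, Equiv.symm_apply_apply]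
    rw [← Finset.sum_filter, Finset.sum_const, card_filter_val_lt hkm]
    simp [hk0.ne']
  have hsumw2 : ∑ j, w j ^ 2 = 1 / k := by
    rw [← Equiv.sum_comp τ]
    simp only [hw, Equiv.symm_apply_apply, ite_pow]
    rw [zero_pow two_ne_zero, ← Finset.sum_filter, Finset.sum_const, card_filter_val_lt hkm]
    rw [nsmul_eq_mul]
    field_simp
  have hVar : Var[∑ j, fun θ : Fin m → T => w j * f (xs j) (θ j); Measure.pi fun _ : Fin m => ν]
      ≤ σ ^ 2 / k := by
    rw [variance_sum_pi hZ]
    calc ∑ j, Var[fun t => w j * f (xs j) t; ν] = ∑ j, w j ^ 2 * Var[f (xs j); ν] :=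
          Finset.sum_congr rfl fun j _ => variance_const_mul _ _ _
      _ ≤ ∑ j, w j ^ 2 * σ ^ 2 := by gcongr with j; exact hvar j
      _ = σ ^ 2 / k := by rw [← Finset.sum_mul, hsumw2]; ring
  have hmean : ∫ θ, (∑ j, fun θ : Fin m → T => w j * f (xs j) (θ j)) θ
      ∂(Measure.pi fun _ : Fin m => ν) = ∑ j, w j * regressionFunction f ν (xs j) := by
    simp_rw [Finset.sum_apply]
    rw [integral_finsetSum]
    · refine Finset.sum_congr rfl fun j _ => ?_
      rw [integral_const_mul, regressionFunction]
      congr 1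
      exact integral_comp_eval (μ := fun _ : Fin m => ν) (hint (xs j)).aestronglyMeasurable
    · intro j _
      exact (integrable_comp_eval (μ := fun _ : Fin m => ν) (hint (xs j))).const_mul _
  have hbias : (regressionFunction f ν x - ∑ j, w j * regressionFunction f ν (xs j)) ^ 2
      ≤ (L : ℝ) ^ 2 / k * ∑ l : Fin m with l.val < k, ‖x - xs (nnIndex xs x l)‖ ^ 2 := by
    have e1 : regressionFunction f ν x - ∑ j, w j * regressionFunction f ν (xs j)
        = (1 / (k : ℝ)) * ∑ l : Fin m with l.val < k,
          (regressionFunction f ν x - regressionFunction f ν (xs (nnIndex xs x l))) := by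
      rw [← kNNRegressor_eq_sum k xs (fun j => regressionFunction f ν (xs j)) x, kNNRegressor,
        Finset.sum_sub_distrib, Finset.sum_const, card_filter_val_lt hkm, mul_sub, nsmul_eq_mul]
      field_simp
    rw [e1, mul_pow]
    -- Cauchy–Schwarz over the `k` neighbors.
    calc _ ≤ (1 / (k : ℝ)) ^ 2 * (k * ∑ l : Fin m with l.val < k,
          (regressionFunction f ν x - regressionFunction f ν (xs (nnIndex xs x l))) ^ 2) := by
          gcongr
          refine sq_sum_le_card_mul_sum_sq.trans (le_of_eq ?_)
          rw [card_filter_val_lt hkm]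
      _ ≤ (1 / (k : ℝ)) ^ 2 * (k * ∑ l : Fin m with l.val < k,
          (L : ℝ) ^ 2 * ‖x - xs (nnIndex xs x l)‖ ^ 2) := by
          gcongr with l
          rw [← mul_pow]
          exact sq_le_sq' (by linarith [neg_le_of_abs_le (abs_regressionFunction_sub_le hf hint x
            (xs (nnIndex xs x l)))]) (le_of_abs_le (abs_regressionFunction_sub_le hf hint _ _))
      _ = _ := by rw [← Finset.mul_sum]; field_simp
  rw [hmean]
  refine ENNReal.ofReal_le_ofReal ?_
  have hB := sum_sq_dist_nnIndex_le_sum_inf hk hkm xs x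
  have : (L : ℝ) ^ 2 / k * ∑ l : Fin m with l.val < k, ‖x - xs (nnIndex xs x l)‖ ^ 2
      ≤ (L : ℝ) ^ 2 / k * ∑ b, (indexBlock m k b).inf' (indexBlock_nonempty hk hkm b)
        fun j => ‖x - xs j‖ ^ 2 := by gcongr
  linarith

/-! ### The expected squared nearest-neighbor distance -/

/-- The probability that a point of law `μ'` is at squared distance more than `s` from `x`. -/
noncomputable def distTail {E : Type*} [NormedAddCommGroup E] [MeasurableSpace E] (μ' : Measure E)
    (x : E) (s : ℝ) : ℝ≥0∞ :=
  μ' {y | s < ‖x - y‖ ^ 2}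

/-- The expected squared distance from `x` to its nearest neighbor among `n ≥ 1` independent points
of law `μ'`, as an integral of tail probabilities. -/
noncomputable def nnSqDist {E : Type*} [NormedAddCommGroup E] [MeasurableSpace E] (μ' : Measure E)
    (n : ℕ) (x : E) : ℝ≥0∞ :=
  ∫⁻ s in Set.Ioi (0 : ℝ), distTail μ' x s ^ n

lemma measurable_finset_inf' {ι W : Type*} [MeasurableSpace W] {S : Finset ι} (hS : S.Nonempty)
    {g : ι → W → ℝ} (hg : ∀ j, Measurable (g j)) :
    Measurable fun w => S.inf' hS fun j => g j w := by
  refine measurable_of_Ioi fun s => ?_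
  have : (fun w => S.inf' hS fun j => g j w) ⁻¹' Set.Ioi s = ⋂ j ∈ S, {w | s < g j w} := by
    ext w; simp [Finset.lt_inf'_iff]
  rw [this]
  exact Finset.measurableSet_biInter _ fun j _ => measurableSet_lt measurable_const (hg j)

section

variable {E : Type*} [NormedAddCommGroup E] [MeasurableSpace E]

lemma distTail_antitone (μ' : Measure E) (x : E) : Antitone (distTail μ' x) :=
  fun _ _ hst => measure_mono fun _ hy => lt_of_le_of_lt hst hy

variable [BorelSpace E]

lemma measurableSet_lt_sq_dist (x : E) (s : ℝ) : MeasurableSet {y : E | s < ‖x - y‖ ^ 2} := by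
  refine measurableSet_lt measurable_const ?_
  fun_prop

lemma measurable_nnSqDist [SecondCountableTopology E] (μ' : Measure E)
    [IsProbabilityMeasure μ'] (n : ℕ) :
    Measurable (nnSqDist μ' n) := by
  have h : Measurable fun q : E × ℝ => distTail μ' q.1 q.2 := by
    refine measurable_measure_prodMk_left (s := {z : (E × ℝ) × E | z.1.2 < ‖z.1.1 - z.2‖ ^ 2}) ?_
    refine measurableSet_lt (by fun_prop) ?_
    fun_prop
  exact Measurable.lintegral_prod_right' (f := fun q : E × ℝ => distTail μ' q.1 q.2 ^ n)
    (h.pow_const n)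

variable {W : Type*} [MeasurableSpace W] {ρ : Measure W} {ι : Type*}
  {Y : ι → W → E} {μ' : Measure E}

lemma measure_lt_inf'_sq_dist (hY : ∀ j, Measurable (Y j)) (hind : iIndepFun Y ρ)
    (hlaw : ∀ j, ρ.map (Y j) = μ') {S : Finset ι} (hS : S.Nonempty) (x : E) (s : ℝ) :
    ρ {w | s < S.inf' hS fun j => ‖x - Y j w‖ ^ 2} = distTail μ' x s ^ S.card := by
  have h := hind.measure_inter_preimage_eq_mul S (sets := fun _ => {y : E | s < ‖x - y‖ ^ 2})
    fun _ _ => measurableSet_lt_sq_dist x s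
  have h' : {w | s < S.inf' hS fun j => ‖x - Y j w‖ ^ 2}
      = ⋂ j ∈ S, Y j ⁻¹' {y : E | s < ‖x - y‖ ^ 2} := by
    ext w; simp [Finset.lt_inf'_iff]
  rw [h', h, ← Finset.prod_const]
  refine Finset.prod_congr rfl fun j _ => ?_
  rw [distTail, ← hlaw j, Measure.map_apply (hY j) (measurableSet_lt_sq_dist x s)]

/-- Layer-cake formula: by independence, the tail of the minimum is a power of the tail of one
distance. -/
lemma lintegral_inf'_sq_dist (hY : ∀ j, Measurable (Y j)) (hind : iIndepFun Y ρ)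
    (hlaw : ∀ j, ρ.map (Y j) = μ') {S : Finset ι} (hS : S.Nonempty) (x : E) :
    ∫⁻ w, ENNReal.ofReal (S.inf' hS fun j => ‖x - Y j w‖ ^ 2) ∂ρ = nnSqDist μ' S.card x := by
  rw [lintegral_eq_lintegral_meas_lt ρ, nnSqDist]
  · simp_rw [measure_lt_inf'_sq_dist hY hind hlaw hS]
  · exact ae_of_all _ fun w => Finset.le_inf' hS _ fun j _ => sq_nonneg _
  · refine (measurable_finset_inf' hS (g := fun j w => ‖x - Y j w‖ ^ 2) fun j => ?_).aemeasurable
    exact ((hY j).const_sub x).norm.pow_const 2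

/-- A finite first moment of the norm of the smallest among `m₀` points yields a finite second
moment of the distance to the nearest among `2 * m₀` points. -/
lemma nnSqDist_two_mul_le [IsProbabilityMeasure ρ] {Y : ℕ → W → E} (hY : ∀ j, Measurable (Y j))
    (hind : iIndepFun Y ρ) (hlaw : ∀ j, ρ.map (Y j) = μ') {m₀ : ℕ} (hm₀ : 1 ≤ m₀)
    (hint : Integrable (fun w => ⨅ j : Fin m₀, ‖Y j w‖) ρ) (x : E) :
    nnSqDist μ' (2 * m₀) x
      ≤ ENNReal.ofReal ((‖x‖ + ∫ w, (⨅ j : Fin m₀, ‖Y j w‖) ∂ρ) ^ 2) := by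
  have hS : (Finset.range m₀).Nonempty := by simpa using (by omega : m₀ ≠ 0)
  have : Nonempty (Fin m₀) := ⟨⟨0, hm₀⟩⟩
  set D : W → ℝ := fun w => (Finset.range m₀).inf' hS fun j => ‖x - Y j w‖ ^ 2 with hD
  have hD0 : ∀ w, 0 ≤ D w := fun w => Finset.le_inf' hS _ fun j _ => sq_nonneg _
  have hDm : Measurable D := measurable_finset_inf' hS (g := fun j w => ‖x - Y j w‖ ^ 2)
    fun j => ((hY j).const_sub x).norm.pow_const 2
  -- Doubling the sample squares the tail of `D`, which is the tail of the minimum of two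
  -- independent copies of `D`.
  have h1 : nnSqDist μ' (2 * m₀) x
      = ∫⁻ q, ENNReal.ofReal (min (D q.1) (D q.2)) ∂(ρ.prod ρ) := by
    rw [lintegral_eq_lintegral_meas_lt (ρ.prod ρ), nnSqDist]
    · refine lintegral_congr fun s => ?_
      have : {q : W × W | s < min (D q.1) (D q.2)} = {w | s < D w} ×ˢ {w | s < D w} := by
        ext q; simp
      rw [this, Measure.prod_prod, measure_lt_inf'_sq_dist hY hind hlaw hS x s, Finset.card_range,
        two_mul, pow_add]
    · exact ae_of_all _ fun q => le_min (hD0 _) (hD0 _)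
    · exact ((hDm.comp measurable_fst).min (hDm.comp measurable_snd)).aemeasurable
  have hsm : Measurable fun w => ENNReal.ofReal (√(D w)) := hDm.sqrt.ennreal_ofReal
  -- Since `min a b ≤ √a √b`, independence of the copies leaves a product of two first moments of a
  -- distance.
  have h2 : nnSqDist μ' (2 * m₀) x
      ≤ (∫⁻ w, ENNReal.ofReal (√(D w)) ∂ρ) * ∫⁻ w, ENNReal.ofReal (√(D w)) ∂ρ := by
    rw [h1, ← lintegral_prod_mul hsm.aemeasurable hsm.aemeasurable]
    refine lintegral_mono fun q => ?_
    simp only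
    rw [← ENNReal.ofReal_mul (Real.sqrt_nonneg _)]
    refine ENNReal.ofReal_le_ofReal ?_
    rw [← Real.sqrt_mul (hD0 _)]
    refine Real.le_sqrt_of_sq_le ?_
    rw [sq]
    exact mul_le_mul (min_le_left _ _) (min_le_right _ _) (le_min (hD0 _) (hD0 _)) (hD0 _)
  have h3 : ∀ w, √(D w) ≤ ‖x‖ + ⨅ j : Fin m₀, ‖Y j w‖ := by
    intro w
    obtain ⟨j, hj⟩ := exists_eq_ciInf_of_finite (f := fun j : Fin m₀ => ‖Y j w‖)
    rw [← hj]
    refine (Real.sqrt_le_sqrt (Finset.inf'_le (fun j => ‖x - Y j w‖ ^ 2)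
      (Finset.mem_range.2 j.2))).trans ?_
    rw [Real.sqrt_sq (norm_nonneg _)]
    exact norm_sub_le _ _
  have hA0 : ∀ w, 0 ≤ ⨅ j : Fin m₀, ‖Y j w‖ := fun w => Real.iInf_nonneg fun j => norm_nonneg _
  have h4 : ∫⁻ w, ENNReal.ofReal (√(D w)) ∂ρ
      ≤ ENNReal.ofReal (‖x‖ + ∫ w, (⨅ j : Fin m₀, ‖Y j w‖) ∂ρ) := by
    calc _ ≤ ∫⁻ w, ENNReal.ofReal (‖x‖ + ⨅ j : Fin m₀, ‖Y j w‖) ∂ρ :=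
          lintegral_mono fun w => ENNReal.ofReal_le_ofReal (h3 w)
      _ = _ := by
          have hi : Integrable (fun w => ‖x‖ + ⨅ j : Fin m₀, ‖Y j w‖) ρ :=
            (integrable_const _).add hint
          rw [← ofReal_integral_eq_lintegral_ofReal hi
            (ae_of_all _ fun w => add_nonneg (norm_nonneg _) (hA0 w)),
            integral_add (integrable_const _) hint]
          simp
  rw [sq, ENNReal.ofReal_mul (add_nonneg (norm_nonneg _) (integral_nonneg hA0))]
  exact h2.trans (mul_le_mul' h4 h4)

/-- From `1 - c ≤ exp (-c)`, which turns powers of the tail into exponentials. -/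
lemma distTail_le_of_le_measureReal [IsProbabilityMeasure μ'] {x : E} {r c : ℝ}
    (hr : 0 ≤ r) (h : c ≤ μ'.real (Metric.closedBall x r)) :
    distTail μ' x (r ^ 2) ≤ ENNReal.ofReal (Real.exp (-c)) := by
  have : {y : E | r ^ 2 < ‖x - y‖ ^ 2} = (Metric.closedBall x r)ᶜ := by
    ext y
    simp only [Set.mem_ofPred_eq, Set.mem_compl_iff, Metric.mem_closedBall, not_le, dist_comm y x,
      dist_eq_norm]
    exact sq_lt_sq₀ hr (norm_nonneg _)
  rw [distTail, this, ← ofReal_measureReal,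
    probReal_compl_eq_one_sub Metric.isClosed_closedBall.measurableSet]
  refine ENNReal.ofReal_le_ofReal ?_
  linarith [Real.add_one_le_exp (-c)]

/-- Split at `√s = r₀`. Below, the mass bound applies at radius `√s`. Above, `n - n₀` of the `n`
tail factors are bounded by their value at `r₀`, and the other `n₀` are kept to ensure integrability
in `s`. -/
lemma nnSqDist_le_of_mass [IsProbabilityMeasure μ'] {d : ℕ} (hd : 1 ≤ d) {x : E} {a r₀ : ℝ}
    (ha : 0 < a) (hr₀ : 0 < r₀)
    (hmass : ∀ r, 0 ≤ r → r ≤ r₀ → a * r ^ d ≤ μ'.real (Metric.closedBall x r)) {n n₀ : ℕ}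
    (hn : 1 ≤ n) (hn₀ : n₀ ≤ n) :
    nnSqDist μ' n x
      ≤ ENNReal.ofReal ((n * a) ^ (-(2 / (d : ℝ))) * Real.Gamma (2 / (d : ℝ) + 1))
        + ENNReal.ofReal (Real.exp (-(((n : ℝ) - n₀) * (a * r₀ ^ d)))) * nnSqDist μ' n₀ x := by
  have hd0 : (0 : ℝ) < d := by exact_mod_cast hd
  have hn0 : (0 : ℝ) < n := by exact_mod_cast hn
  have hpow : ∀ (c : ℝ) (j : ℕ), ENNReal.ofReal (Real.exp (-c)) ^ j
      = ENNReal.ofReal (Real.exp (-(j * c))) := by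
    intro c j
    rw [← ENNReal.ofReal_pow (Real.exp_pos _).le, ← Real.exp_nat_mul]
    ring_nf
  have hpt : ∀ s ∈ Set.Ioi (0 : ℝ), distTail μ' x s ^ n
      ≤ ENNReal.ofReal (Real.exp (-(n * a) * s ^ ((d : ℝ) / 2)))
        + ENNReal.ofReal (Real.exp (-(((n : ℝ) - n₀) * (a * r₀ ^ d)))) * distTail μ' x s ^ n₀ := by
    intro s hs
    have hs0 : 0 ≤ s := le_of_lt hs
    rcases le_or_gt (√s) r₀ with h | h
    · refine le_trans ?_ le_self_add
      have h1 := distTail_le_of_le_measureReal (Real.sqrt_nonneg s) (hmass _ (Real.sqrt_nonneg s) h)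
      rw [Real.sq_sqrt hs0] at h1
      refine (pow_le_pow_left' h1 n).trans (le_of_eq ?_)
      rw [hpow]
      congr 3
      have : √s ^ d = s ^ ((d : ℝ) / 2) := by
        rw [Real.sqrt_eq_rpow, ← Real.rpow_natCast, ← Real.rpow_mul hs0]
        congr 1; ring
      rw [this]; ring
    · refine le_trans ?_ le_add_self
      have h1 := distTail_le_of_le_measureReal hr₀.le (hmass _ hr₀.le le_rfl)
      have h2 : distTail μ' x s ≤ distTail μ' x (r₀ ^ 2) :=
        distTail_antitone μ' x ((Real.le_sqrt' hr₀).1 h.le)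
      have h3 : distTail μ' x s ^ n = distTail μ' x s ^ (n - n₀) * distTail μ' x s ^ n₀ := by
        rw [← pow_add, Nat.sub_add_cancel hn₀]
      rw [h3]
      gcongr
      refine (pow_le_pow_left' (h2.trans h1) _).trans (le_of_eq ?_)
      rw [hpow, Nat.cast_sub hn₀]
  have hdt : Measurable fun s => distTail μ' x s ^ n₀ :=
    (distTail_antitone μ' x).measurable.pow_const n₀
  calc nnSqDist μ' n x
      ≤ ∫⁻ s in Set.Ioi (0 : ℝ), (ENNReal.ofReal (Real.exp (-(n * a) * s ^ ((d : ℝ) / 2)))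
        + ENNReal.ofReal (Real.exp (-(((n : ℝ) - n₀) * (a * r₀ ^ d)))) * distTail μ' x s ^ n₀) :=
        setLIntegral_mono' measurableSet_Ioi hpt
    _ = _ := by
        rw [lintegral_add_right _ (hdt.const_mul _), lintegral_const_mul _ hdt, ← nnSqDist]
        congr 1
        rw [← ofReal_integral_eq_lintegral_ofReal]
        -- The Gamma integral with exponent `d/2`, whose inverse is the rate `2/d`.
        · rw [integral_exp_neg_mul_rpow (by positivity) (by positivity)]
          congr 3 <;> field_simp
        · have := integrableOn_rpow_mul_exp_neg_mul_rpow (p := (d : ℝ) / 2) (s := 0) (b := n * a)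
            (by norm_num) (by positivity) (by positivity)
          simpa [IntegrableOn] using this
        · exact ae_of_all _ fun s => (Real.exp_pos _).le

end

/-! ### The generalization error in terms of the nearest-neighbor distance -/

/-- The sorting permutation, tie-breaking included, is characterized by finitely many comparisons
between the values. -/
lemma measurableSet_sort_eq {α : Type*} [MeasurableSpace α] {m : ℕ} {g : α → Fin m → ℝ}
    (hg : ∀ j, Measurable fun a => g a j) (τ : Equiv.Perm (Fin m)) :
    MeasurableSet {a | τ = Tuple.sort (g a)} := by
  have : {a | τ = Tuple.sort (g a)}
      = (⋂ i, ⋂ j, ⋂ _ : i ≤ j, {a | g a (τ i) ≤ g a (τ j)})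
        ∩ ⋂ i, ⋂ j, ⋂ _ : i < j, {a | g a (τ i) = g a (τ j) → τ i < τ j} := by
    ext a
    simp [Tuple.eq_sort_iff, Monotone]
  rw [this]
  refine MeasurableSet.inter ?_ ?_
  · exact .iInter fun i => .iInter fun j => .iInter fun _ => measurableSet_le (hg _) (hg _)
  · refine .iInter fun i => .iInter fun j => .iInter fun _ => ?_
    by_cases h : τ i < τ j
    · simp [h]
    · simp only [h, imp_false]
      exact (measurableSet_eq_fun (hg _) (hg _)).compl

lemma measurableSet_sort_symm_lt {α : Type*} [MeasurableSpace α] {m : ℕ} {g : α → Fin m → ℝ}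
    (hg : ∀ j, Measurable fun a => g a j) (k : ℕ) (j : Fin m) :
    MeasurableSet {a | ((Tuple.sort (g a)).symm j).val < k} := by
  have : {a | ((Tuple.sort (g a)).symm j).val < k}
      = ⋃ τ : {τ : Equiv.Perm (Fin m) // (τ.symm j).val < k}, {a | τ.1 = Tuple.sort (g a)} := by
    ext a
    simp
  rw [this]
  exact .iUnion fun τ => measurableSet_sort_eq hg τ.1

lemma measurable_kNNRegressor {α E : Type*} [MeasurableSpace α] [NormedAddCommGroup E]
    [MeasurableSpace E] [BorelSpace E] [SecondCountableTopology E] {m : ℕ} (k : ℕ)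
    {x : α → E} {xs : α → Fin m → E} {ys : α → Fin m → ℝ} (hx : Measurable x)
    (hxs : ∀ j, Measurable fun a => xs a j) (hys : ∀ j, Measurable fun a => ys a j) :
    Measurable fun a => kNNRegressor k (xs a) (ys a) (x a) := by
  simp_rw [kNNRegressor_eq_sum]
  refine Finset.measurable_sum _ fun j _ => Measurable.mul ?_ (hys j)
  refine Measurable.ite ?_ measurable_const measurable_const
  exact measurableSet_sort_symm_lt (fun i => (hx.sub (hxs i)).norm) k j

section

variable {Ω E T : Type*} [MeasurableSpace Ω] [MeasurableSpace E]
  [MeasurableSpace T] {P : Measure Ω} {μ μ' : Measure E} {ν : Measure T} {X : Ω → E}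
  {X' : ℕ → Ω → E} {Θ : ℕ → Ω → T}

/-- The joint law of the evaluation point, the first `m` inputs and the first `m` noises. -/
lemma CovariateShiftModel.map_eq_prod [IsProbabilityMeasure P] [IsProbabilityMeasure μ']
    [IsProbabilityMeasure ν] (h : CovariateShiftModel P μ μ' ν X X' Θ) (m : ℕ) :
    P.map (fun ω => (X ω, (fun j : Fin m => X' j ω), fun j : Fin m => Θ j ω))
      = μ.prod ((Measure.pi fun _ => μ').prod (Measure.pi fun _ => ν)) := by
  have hZ : ∀ j, Measurable fun ω => (X' j ω, Θ j ω) :=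
    fun j => (h.measurable_X' j).prodMk (h.measurable_Θ j)
  have hZlaw : ∀ j, P.map (fun ω => (X' j ω, Θ j ω)) = μ'.prod ν := by
    intro j
    rw [(indepFun_iff_map_prod_eq_prod_map_map (h.measurable_X' j).aemeasurable
      (h.measurable_Θ j).aemeasurable).1 (h.indep_X'_Θ j), h.law_X', h.law_Θ]
  have hZm : Measurable fun ω => fun j : Fin m => (X' j ω, Θ j ω) :=
    measurable_pi_lambda _ fun j => hZ j
  have hpi : P.map (fun ω => fun j : Fin m => (X' j ω, Θ j ω))
      = Measure.pi fun _ : Fin m => μ'.prod ν := by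
    have hi : iIndepFun (fun (j : Fin m) ω => (X' j ω, Θ j ω)) P :=
      h.indep_sample.precomp Fin.val_injective
    rw [(iIndepFun_iff_map_fun_eq_pi_map (f := fun (j : Fin m) ω => (X' j ω, Θ j ω))
      fun j => (hZ j).aemeasurable).1 hi]
    simp_rw [hZlaw]
  have hind : IndepFun X (fun ω => fun j : Fin m => (X' j ω, Θ j ω)) P :=
    h.indep_X_sample.comp (φ := id) (ψ := fun z : ℕ → E × T => fun j : Fin m => z j)
      measurable_id (measurable_pi_lambda _ fun j => measurable_pi_apply _)
  -- Regroups the tuple of pairs (input, noise) into a pair of tuples, so that the noises can be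
  -- integrated first with the inputs frozen.
  have hmp := measurePreserving_arrowProdEquivProdArrow E T (Fin m) (fun _ => μ') (fun _ => ν)
  have hpair : P.map (fun ω => ((fun j : Fin m => X' j ω), fun j : Fin m => Θ j ω))
      = (Measure.pi fun _ => μ').prod (Measure.pi fun _ => ν) := by
    rw [← hmp.map_eq, ← hpi, Measure.map_map hmp.measurable hZm]
    rfl
  have hind' : IndepFun X (fun ω => ((fun j : Fin m => X' j ω), fun j : Fin m => Θ j ω)) P :=
    hind.comp (φ := id) (ψ := MeasurableEquiv.arrowProdEquivProdArrow E T (Fin m))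
      measurable_id hmp.measurable
  have hm2 : Measurable fun ω => ((fun j : Fin m => X' j ω), fun j : Fin m => Θ j ω) :=
    (measurable_pi_lambda _ fun j : Fin m => h.measurable_X' j).prodMk
      (measurable_pi_lambda _ fun j : Fin m => h.measurable_Θ j)
  rw [(indepFun_iff_map_prod_eq_prod_map_map h.measurable_X.aemeasurable hm2.aemeasurable).1 hind',
    hpair, h.law_X]

end

section

variable {Ω E T : Type*} [MeasurableSpace Ω] [NormedAddCommGroup E] [MeasurableSpace E]
  [BorelSpace E] [MeasurableSpace T] {P : Measure Ω} {μ μ' : Measure E} {ν : Measure T} {X : Ω → E}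
  {X' : ℕ → Ω → E} {Θ : ℕ → Ω → T}

/-- All `k` blocks have the same size, hence the same mean minimum, and the factor `1/k` cancels
their number. -/
lemma lintegral_sum_inf'_sq_dist [IsProbabilityMeasure μ'] {m k : ℕ} (hk : 1 ≤ k)
    (hkm : k ≤ m) (a b : ℝ) (ha : 0 ≤ a) (hb : 0 ≤ b) (x : E) :
    ∫⁻ xs, ENNReal.ofReal (a + b / k * ∑ i, (indexBlock m k i).inf'
        (indexBlock_nonempty hk hkm i) fun j => ‖x - xs j‖ ^ 2) ∂(Measure.pi fun _ : Fin m => μ')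
      = ENNReal.ofReal a + ENNReal.ofReal b * nnSqDist μ' (m / k) x := by
  have hk0 : (0 : ℝ) < k := by exact_mod_cast hk
  have hnn : ∀ (xs : Fin m → E) (i : Fin k), 0 ≤ (indexBlock m k i).inf'
      (indexBlock_nonempty hk hkm i) fun j => ‖x - xs j‖ ^ 2 :=
    fun xs i => Finset.le_inf' _ _ fun j _ => sq_nonneg _
  have hmeas : ∀ i : Fin k, Measurable fun xs : Fin m → E => ENNReal.ofReal
      ((indexBlock m k i).inf' (indexBlock_nonempty hk hkm i) fun j => ‖x - xs j‖ ^ 2) :=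
    fun i => (measurable_finset_inf' (indexBlock_nonempty hk hkm i)
      (g := fun j (xs : Fin m → E) => ‖x - xs j‖ ^ 2)
      fun j => (((measurable_pi_apply (X := fun _ : Fin m => E) j).const_sub x).norm).pow_const
        2).ennreal_ofReal
  have hint : ∀ i : Fin k, ∫⁻ xs, ENNReal.ofReal ((indexBlock m k i).inf'
      (indexBlock_nonempty hk hkm i) fun j => ‖x - xs j‖ ^ 2) ∂(Measure.pi fun _ : Fin m => μ')
      = nnSqDist μ' (m / k) x := by
    intro i
    rw [← card_indexBlock hk hkm i]
    refine lintegral_inf'_sq_dist (Y := fun (j : Fin m) (xs : Fin m → E) => xs j)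
      (fun j => measurable_pi_apply j) ?_ ?_ (indexBlock_nonempty hk hkm i) x
    · exact iIndepFun_pi (μ := fun _ : Fin m => μ') (X := fun _ => id)
        fun _ => measurable_id.aemeasurable
    · intro j
      exact (measurePreserving_eval (fun _ : Fin m => μ') j).map_eq
  have hpt : ∀ xs : Fin m → E, ENNReal.ofReal (a + b / k * ∑ i, (indexBlock m k i).inf'
        (indexBlock_nonempty hk hkm i) fun j => ‖x - xs j‖ ^ 2)
      = ENNReal.ofReal a + ENNReal.ofReal (b / k) * ∑ i, ENNReal.ofReal ((indexBlock m k i).inf'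
        (indexBlock_nonempty hk hkm i) fun j => ‖x - xs j‖ ^ 2) := by
    intro xs
    rw [ENNReal.ofReal_add ha (mul_nonneg (by positivity) (Finset.sum_nonneg fun i _ => hnn xs i)),
      ENNReal.ofReal_mul (by positivity), ENNReal.ofReal_sum_of_nonneg fun i _ => hnn xs i]
  simp_rw [hpt]
  rw [lintegral_add_left measurable_const, lintegral_const_mul _
    (Finset.measurable_sum _ fun i _ => hmeas i), lintegral_finsetSum _ fun i _ => hmeas i]
  simp_rw [hint]
  simp only [lintegral_const, measure_univ, mul_one, Finset.sum_const, Finset.card_univ,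
    Fintype.card_fin, nsmul_eq_mul]
  rw [← mul_assoc, ← ENNReal.ofReal_natCast, ← ENNReal.ofReal_mul (by positivity),
    div_mul_cancel₀ _ hk0.ne']

lemma l2GeneralizationError_le [SecondCountableTopology E] [IsProbabilityMeasure P]
    [IsProbabilityMeasure μ]
    [IsProbabilityMeasure μ'] [IsProbabilityMeasure ν] (h : CovariateShiftModel P μ μ' ν X X' Θ)
    {f : E → T → ℝ} (hfm : Measurable (Function.uncurry f)) {L : ℝ≥0}
    (hf : ∀ θ, LipschitzWith L fun x => f x θ) {σ : ℝ}
    (hvar : ∀ x ∈ μ'.support, MemLp (f x) 2 ν ∧ Var[f x; ν] ≤ σ ^ 2) {m k : ℕ} (hk : 1 ≤ k)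
    (hkm : k ≤ m) :
    l2GeneralizationError P f ν X X' Θ m k
      ≤ (ENNReal.ofReal (σ ^ 2 / k)
        + ENNReal.ofReal ((L : ℝ) ^ 2) * ∫⁻ ω, nnSqDist μ' (m / k) (X ω) ∂P) ^ (1 / 2 : ℝ) := by
  have hfx : ∀ x, Measurable (f x) := fun x => hfm.comp measurable_prodMk_left
  obtain ⟨y, hy⟩ := Measure.nonempty_support (IsProbabilityMeasure.ne_zero μ')
  have hint : ∀ x, Integrable (f x) ν := integrable_of_lipschitz_of_integrable hfx hf
    ((hvar y hy).1.integrable (by norm_num))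
  have hr : Measurable (regressionFunction f ν) :=
    (hfm.stronglyMeasurable.integral_prod_right (ν := ν)).measurable
  set F : E × (Fin m → E) × (Fin m → T) → ℝ≥0∞ := fun z => ENNReal.ofReal
    ((regressionFunction f ν z.1
      - kNNRegressor k z.2.1 (fun j => f (z.2.1 j) (z.2.2 j)) z.1) ^ 2) with hF
  have hFm : Measurable F := by
    refine (((hr.comp measurable_fst).sub (measurable_kNNRegressor k measurable_fst
      (fun j => ?_) fun j => ?_)).pow_const 2).ennreal_ofReal
    · exact (measurable_pi_apply j).comp (measurable_fst.comp measurable_snd)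
    · exact hfm.comp (f := fun z : E × (Fin m → E) × (Fin m → T) => (z.2.1 j, z.2.2 j))
        (((measurable_pi_apply j).comp (measurable_fst.comp measurable_snd)).prodMk
        ((measurable_pi_apply j).comp (measurable_snd.comp measurable_snd)))
  have hmX : Measurable fun ω => (X ω, (fun j : Fin m => X' j ω), fun j : Fin m => Θ j ω) :=
    h.measurable_X.prodMk ((measurable_pi_lambda _ fun j : Fin m => h.measurable_X' j).prodMk
      (measurable_pi_lambda _ fun j : Fin m => h.measurable_Θ j))
  -- The variance bound is available only on the support of `μ'`, where almost surely all inputs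
  -- lie.
  have hsupp : ∀ᵐ xs ∂(Measure.pi fun _ : Fin m => μ'), ∀ j, xs j ∈ μ'.support := by
    rw [ae_all_iff]
    intro j
    exact Measure.tendsto_eval_ae_ae.eventually (Measure.support_mem_ae (μ := μ'))
  rw [l2GeneralizationError]
  refine ENNReal.rpow_le_rpow ?_ (by norm_num)
  calc _ = ∫⁻ z, F z ∂(P.map fun ω => (X ω, (fun j : Fin m => X' j ω), fun j : Fin m => Θ j ω)) :=
        (lintegral_map hFm hmX).symm
    _ = ∫⁻ x, ∫⁻ xs, ∫⁻ θ, F (x, xs, θ) ∂(Measure.pi fun _ : Fin m => ν)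
          ∂(Measure.pi fun _ : Fin m => μ') ∂μ := by
        rw [h.map_eq_prod, lintegral_prod _ hFm.aemeasurable]
        refine lintegral_congr fun x => ?_
        exact lintegral_prod (fun z => F (x, z)) (hFm.comp measurable_prodMk_left).aemeasurable
    _ ≤ ∫⁻ x, ∫⁻ xs, ENNReal.ofReal (σ ^ 2 / k + (L : ℝ) ^ 2 / k * ∑ i, (indexBlock m k i).inf'
          (indexBlock_nonempty hk hkm i) fun j => ‖x - xs j‖ ^ 2)
          ∂(Measure.pi fun _ : Fin m => μ') ∂μ := by
        refine lintegral_mono fun x => lintegral_mono_ae ?_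
        filter_upwards [hsupp] with xs hxs
        exact lintegral_sq_kNNRegressor_le hf hint hk hkm xs x (fun j => (hvar _ (hxs j)).1)
          fun j => (hvar _ (hxs j)).2
    _ = ∫⁻ x, (ENNReal.ofReal (σ ^ 2 / k)
          + ENNReal.ofReal ((L : ℝ) ^ 2) * nnSqDist μ' (m / k) x) ∂μ :=
        lintegral_congr fun x =>
          lintegral_sum_inf'_sq_dist hk hkm _ _ (by positivity) (by positivity) x
    _ = _ := by
        rw [lintegral_add_left measurable_const,
          lintegral_const_mul _ (measurable_nnSqDist μ' _), lintegral_const, measure_univ, mul_one,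
          ← h.law_X, lintegral_map (measurable_nnSqDist μ' _) h.measurable_X]

end

/-! ### Asymptotics of the nearest-neighbor distance -/

/-- Raise `y / q ≤ exp (y / q)` to the power `q`. -/
lemma rpow_mul_exp_neg_le {q y : ℝ} (hq : 0 < q) (hy : 0 ≤ y) :
    y ^ q * Real.exp (-y) ≤ q ^ q := by
  have h : y ≤ q * Real.exp (y / q) := by
    have := Real.add_one_le_exp (y / q)
    calc y = q * (y / q) := by field_simp
      _ ≤ q * Real.exp (y / q) := by gcongr; linarith
  calc y ^ q * Real.exp (-y) ≤ (q * Real.exp (y / q)) ^ q * Real.exp (-y) := by gcongr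
    _ = q ^ q := by
      rw [Real.mul_rpow hq.le (Real.exp_pos _).le, ← Real.exp_mul, div_mul_cancel₀ _ hq.ne',
        mul_assoc, ← Real.exp_add]
      simp

section

variable {E : Type*} [NormedAddCommGroup E] [MeasurableSpace E] [BorelSpace E]

variable {μ' : Measure E} [IsProbabilityMeasure μ']

/-- The mass constant is split as `b * p`, with `p` the density at `x`, because `b` takes two values
later: `κ` times the unit ball volume for domination, half that volume for the pointwise limit. -/
lemma rpow_mul_nnSqDist_le {d : ℕ} (hd : 1 ≤ d) {x : E} {b p r₀ : ℝ} (hb : 0 < b) (hp : 0 < p)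
    (hr₀ : 0 < r₀)
    (hmass : ∀ r, 0 ≤ r → r ≤ r₀ → b * p * r ^ d ≤ μ'.real (Metric.closedBall x r)) {n n₀ : ℕ}
    (hn : 1 ≤ n) (hn₀ : n₀ ≤ n) :
    ENNReal.ofReal ((n : ℝ) ^ (2 / (d : ℝ))) * nnSqDist μ' n x
      ≤ ENNReal.ofReal (b ^ (-(2 / (d : ℝ))) * Real.Gamma (2 / (d : ℝ) + 1)
          * (1 / p ^ (2 / (d : ℝ))))
        + ENNReal.ofReal ((n : ℝ) ^ (2 / (d : ℝ))
          * Real.exp (-(((n : ℝ) - n₀) * (b * p * r₀ ^ d)))) * nnSqDist μ' n₀ x := by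
  have hn0 : (0 : ℝ) < n := by exact_mod_cast hn
  refine (mul_le_mul_right (nnSqDist_le_of_mass hd (mul_pos hb hp) hr₀ hmass hn hn₀) _).trans
    (le_of_eq ?_)
  rw [mul_add, ← mul_assoc (ENNReal.ofReal _) (ENNReal.ofReal _),
    ← ENNReal.ofReal_mul (by positivity),
    ← ENNReal.ofReal_mul (by positivity)]
  congr 2
  rw [Real.mul_rpow hn0.le (by positivity), Real.mul_rpow hb.le hp.le, Real.rpow_neg hn0.le,
    Real.rpow_neg hp.le]
  field_simp

/-- The exponential kills the second term for each fixed `x`, so `r₀` may depend on `x` and leaves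
no trace in the limit. -/
lemma limsup_rpow_mul_nnSqDist_le {d : ℕ} (hd : 1 ≤ d) {x : E} {b p r₀ : ℝ} (hb : 0 < b)
    (hp : 0 < p) (hr₀ : 0 < r₀)
    (hmass : ∀ r, 0 ≤ r → r ≤ r₀ → b * p * r ^ d ≤ μ'.real (Metric.closedBall x r)) {n₀ : ℕ}
    (hfin : nnSqDist μ' n₀ x ≠ ∞) :
    limsup (fun n : ℕ => ENNReal.ofReal ((n : ℝ) ^ (2 / (d : ℝ))) * nnSqDist μ' n x) atTop
      ≤ ENNReal.ofReal (b ^ (-(2 / (d : ℝ))) * Real.Gamma (2 / (d : ℝ) + 1)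
          * (1 / p ^ (2 / (d : ℝ)))) := by
  set c := b * p * r₀ ^ d with hc
  have hc0 : 0 < c := by positivity
  have hreal : Tendsto (fun n : ℕ => (n : ℝ) ^ (2 / (d : ℝ)) * Real.exp (-(((n : ℝ) - n₀) * c)))
      atTop (𝓝 0) := by
    have h1 := ((tendsto_rpow_mul_exp_neg_mul_atTop_nhds_zero (2 / (d : ℝ)) c hc0).comp
      tendsto_natCast_atTop_atTop).mul_const (Real.exp (n₀ * c))
    rw [zero_mul] at h1
    refine h1.congr fun n => ?_
    simp only [Function.comp_apply]
    rw [mul_assoc, ← Real.exp_add]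
    ring_nf
  have hlim : Tendsto (fun n : ℕ => ENNReal.ofReal (b ^ (-(2 / (d : ℝ)))
      * Real.Gamma (2 / (d : ℝ) + 1) * (1 / p ^ (2 / (d : ℝ))))
        + ENNReal.ofReal ((n : ℝ) ^ (2 / (d : ℝ))
          * Real.exp (-(((n : ℝ) - n₀) * c))) * nnSqDist μ' n₀ x) atTop
      (𝓝 (ENNReal.ofReal (b ^ (-(2 / (d : ℝ)))
      * Real.Gamma (2 / (d : ℝ) + 1) * (1 / p ^ (2 / (d : ℝ)))))) := by
    have h2 := ENNReal.Tendsto.mul_const (ENNReal.tendsto_ofReal hreal)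
      (b := nnSqDist μ' n₀ x) (Or.inr hfin)
    have h3 := (tendsto_const_nhds (x := ENNReal.ofReal (b ^ (-(2 / (d : ℝ)))
      * Real.Gamma (2 / (d : ℝ) + 1) * (1 / p ^ (2 / (d : ℝ)))))).add h2
    simpa using h3
  rw [← hlim.limsup_eq]
  refine limsup_le_limsup ?_
  filter_upwards [eventually_ge_atTop 1, eventually_ge_atTop n₀] with n h1 h2
  exact rpow_mul_nnSqDist_le hd hb hp hr₀ hmass h1 h2

/-- Provides the dominating function: the bound is uniform in `n`, and its dependence on `x` and `p`
is exactly the quantity assumed integrable. -/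
lemma rpow_mul_nnSqDist_le_of_two_mul_le {d : ℕ} (hd : 1 ≤ d) {x : E} {b p r₀ a : ℝ} (hb : 0 < b)
    (hp : 0 < p) (hr₀ : 0 < r₀)
    (hmass : ∀ r, 0 ≤ r → r ≤ r₀ → b * p * r ^ d ≤ μ'.real (Metric.closedBall x r)) {n n₀ : ℕ}
    (hn : 1 ≤ n) (hn₀ : 2 * n₀ ≤ n) (hmoment : nnSqDist μ' n₀ x ≤ ENNReal.ofReal ((‖x‖ + a) ^ 2)) :
    ENNReal.ofReal ((n : ℝ) ^ (2 / (d : ℝ))) * nnSqDist μ' n x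
      ≤ ENNReal.ofReal ((b ^ (-(2 / (d : ℝ))) * Real.Gamma (2 / (d : ℝ) + 1)
          + (2 / (d : ℝ)) ^ (2 / (d : ℝ)) * (b * r₀ ^ d / 2) ^ (-(2 / (d : ℝ)))
            * (2 * (1 + a ^ 2)))
          * ((1 + ‖x‖ ^ 2) / p ^ (2 / (d : ℝ)))) := by
  have hd0 : (0 : ℝ) < d := by exact_mod_cast hd
  have hn0 : (0 : ℝ) < n := by exact_mod_cast hn
  have hn₀' : 2 * (n₀ : ℝ) ≤ n := by exact_mod_cast hn₀
  set q := 2 / (d : ℝ) with hq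
  have hq0 : 0 < q := by positivity
  have hG : 0 < Real.Gamma (q + 1) := Real.Gamma_pos_of_pos (by positivity)
  refine (rpow_mul_nnSqDist_le hd hb hp hr₀ hmass hn (by omega : n₀ ≤ n)).trans ?_
  refine (add_le_add_right (mul_le_mul_right hmoment _) _).trans ?_
  rw [← ENNReal.ofReal_mul (by positivity), ← ENNReal.ofReal_add (by positivity) (by positivity)]
  refine ENNReal.ofReal_le_ofReal ?_
  rw [add_mul]
  have hexp : (n : ℝ) ^ q * Real.exp (-(((n : ℝ) - n₀) * (b * p * r₀ ^ d)))
      ≤ q ^ q * (b * r₀ ^ d / 2) ^ (-q) * (1 / p ^ q) := by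
    -- As `n ≥ 2 n₀` gives `n - n₀ ≥ n / 2`, the exponent is at least `y`. Trading `n ^ q` for `y ^
    -- q` releases the factor `p ^ (-q)`.
    set y := (n : ℝ) * p * (b * r₀ ^ d / 2) with hy
    have hy0 : 0 < y := by positivity
    have h1 : Real.exp (-(((n : ℝ) - n₀) * (b * p * r₀ ^ d))) ≤ Real.exp (-y) := by
      refine Real.exp_le_exp.2 (neg_le_neg ?_)
      calc y = (n : ℝ) / 2 * (b * p * r₀ ^ d) := by rw [hy]; ring
        _ ≤ ((n : ℝ) - n₀) * (b * p * r₀ ^ d) := by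
          gcongr; linarith
    have h2 : (n : ℝ) ^ q = y ^ q * (b * r₀ ^ d / 2) ^ (-q) * (1 / p ^ q) := by
      rw [hy, Real.mul_rpow (by positivity) (by positivity), Real.mul_rpow hn0.le hp.le,
        Real.rpow_neg (by positivity)]
      have : 0 < (b * r₀ ^ d / 2) ^ q := by positivity
      field_simp
    calc _ ≤ (n : ℝ) ^ q * Real.exp (-y) := by gcongr
      _ = (y ^ q * Real.exp (-y)) * (b * r₀ ^ d / 2) ^ (-q) * (1 / p ^ q) := by rw [h2]; ring
      _ ≤ _ := by gcongr; exact rpow_mul_exp_neg_le hq0 hy0.le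
  have hsq : (‖x‖ + a) ^ 2 ≤ 2 * (1 + a ^ 2) * (1 + ‖x‖ ^ 2) := by
    nlinarith [sq_nonneg (‖x‖ - a), sq_nonneg (‖x‖ * a)]
  refine add_le_add ?_ ?_
  · gcongr
    nlinarith [sq_nonneg ‖x‖]
  · calc _ ≤ (q ^ q * (b * r₀ ^ d / 2) ^ (-q) * (1 / p ^ q))
            * (2 * (1 + a ^ 2) * (1 + ‖x‖ ^ 2)) := by
          gcongr
      _ = _ := by ring

variable [NormedSpace ℝ E] [FiniteDimensional ℝ E]

/-- By continuity the density exceeds half its value at `x` on a small ball. The radius depends on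
`x`, but the constant does not involve `κ`. -/
lemma StrongSupport.exists_local_mass {vol μ μ' : Measure E} [vol.IsAddHaarMeasure]
    [IsFiniteMeasure μ'] {U : Set E} {p : E → ℝ} (h : StrongSupport vol μ μ' U p) {x : E}
    (hx : x ∈ U) : ∃ δ : ℝ, 0 < δ ∧ ∀ r : ℝ, 0 ≤ r → r ≤ δ →
      vol.real (Metric.closedBall 0 1) / 2 * p x * r ^ Module.finrank ℝ E
        ≤ μ'.real (Metric.closedBall x r) := by
  have hp := h.pos x hx
  have hev : ∀ᶠ y in 𝓝 x, y ∈ U ∧ p x / 2 < p y :=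
    (h.isOpen.eventually_mem hx).and ((h.continuousOn.continuousAt (h.isOpen.mem_nhds hx)).eventually
      (lt_mem_nhds (by linarith)))
  obtain ⟨ε, hε, hball⟩ := Metric.eventually_nhds_iff_ball.1 hev
  refine ⟨ε / 2, by linarith, fun r hr0 hr => ?_⟩
  have hsub : Metric.closedBall x r ⊆ Metric.ball x ε :=
    Metric.closedBall_subset_ball (by linarith)
  have hU : Metric.closedBall x r ⊆ U := fun y hy => (hball y (hsub hy)).1
  have hms : MeasurableSet (Metric.closedBall x r) := Metric.isClosed_closedBall.measurableSet
  have h1 : μ' (Metric.closedBall x r)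
      = ∫⁻ y in Metric.closedBall x r, ENNReal.ofReal (p y) ∂vol := by
    rw [← Measure.restrict_eq_self μ' hU, h.density, withDensity_apply _ hms,
      Measure.restrict_restrict hms, Set.inter_eq_left.2 hU]
  have h2 : ENNReal.ofReal (p x / 2) * vol (Metric.closedBall x r)
      ≤ μ' (Metric.closedBall x r) := by
    rw [h1, ← setLIntegral_const]
    exact setLIntegral_mono' hms fun y hy => ENNReal.ofReal_le_ofReal (hball y (hsub hy)).2.le
  rw [Measure.addHaar_closedBall' vol x hr0] at h2
  have h3 := ENNReal.toReal_mono (measure_ne_top _ _) h2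
  rw [ENNReal.toReal_mul, ENNReal.toReal_mul, ENNReal.toReal_ofReal (by linarith),
    ENNReal.toReal_ofReal (by positivity)] at h3
  calc _ = p x / 2 * (r ^ Module.finrank ℝ E * (vol (Metric.closedBall 0 1)).toReal) := by
        rw [measureReal_def]; ring
    _ ≤ _ := h3

/-- The asymptotic upper bound on the mean squared distance from `X` to its nearest neighbor. -/
lemma limsup_lintegral_nnSqDist_le {d : ℕ} (hd : 1 ≤ d) (hdim : Module.finrank ℝ E = d)
    {vol : Measure E} [vol.IsAddHaarMeasure] {μ : Measure E}
    {Ω : Type*} [MeasurableSpace Ω] {P : Measure Ω} {X : Ω → E} (hX : Measurable X)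
    (hlaw : P.map X = μ) {U : Set E} {p : E → ℝ} (h : StrongSupport vol μ μ' U p) {n₀ : ℕ}
    (hn₀ : 1 ≤ n₀) {a : ℝ} (hmoment : ∀ x, nnSqDist μ' n₀ x ≤ ENNReal.ofReal ((‖x‖ + a) ^ 2))
    (hint : Integrable (fun ω => (1 + ‖X ω‖ ^ 2) / p (X ω) ^ (2 / (d : ℝ))) P) :
    limsup (fun n : ℕ => ENNReal.ofReal ((n : ℝ) ^ (2 / (d : ℝ)))
        * ∫⁻ ω, nnSqDist μ' n (X ω) ∂P) atTop
      ≤ ENNReal.ofReal ((vol.real (Metric.closedBall 0 1) / 2) ^ (-(2 / (d : ℝ)))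
          * Real.Gamma (2 / (d : ℝ) + 1) * ∫ ω, 1 / p (X ω) ^ (2 / (d : ℝ)) ∂P) := by
  have : ProperSpace E := FiniteDimensional.proper ℝ E
  subst hdim
  set d := Module.finrank ℝ E with hddef
  have hd0 : (0 : ℝ) < d := by exact_mod_cast hd
  set q := 2 / (d : ℝ) with hq
  have hG : 0 < Real.Gamma (q + 1) := Real.Gamma_pos_of_pos (by positivity)
  set v := vol.real (Metric.closedBall (0 : E) 1) with hv
  have hv0 : 0 < v := ENNReal.toReal_pos (Metric.measure_closedBall_pos vol 0 one_pos).ne'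
    measure_closedBall_lt_top.ne
  have hXU : ∀ᵐ ω ∂P, X ω ∈ U := by
    have h1 : ∀ᵐ x ∂μ, x ∈ U := by
      filter_upwards [Measure.support_mem_ae (μ := μ)] with x hx using h.support_subset hx
    rw [← hlaw] at h1
    exact ae_of_ae_map hX.aemeasurable h1
  obtain ⟨κ, hκ0, -, rκ, hrκ, hmass⟩ := h.minimal_mass
  set F : ℕ → Ω → ℝ≥0∞ := fun n ω => ENNReal.ofReal ((n : ℝ) ^ q) * nnSqDist μ' n (X ω) with hF
  have hFm : ∀ n, Measurable (F n) := fun n =>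
    ((measurable_nnSqDist μ' n).comp hX).const_mul _
  have hFint : ∀ n : ℕ, ENNReal.ofReal ((n : ℝ) ^ q) * ∫⁻ ω, nnSqDist μ' n (X ω) ∂P
      = ∫⁻ ω, F n ω ∂P := fun n =>
    (lintegral_const_mul _ ((measurable_nnSqDist μ' n).comp hX)).symm
  set K := (κ * v) ^ (-q) * Real.Gamma (q + 1)
    + q ^ q * (κ * v * rκ ^ d / 2) ^ (-q) * (2 * (1 + a ^ 2)) with hK
  set g : Ω → ℝ≥0∞ := fun ω => ENNReal.ofReal (K * ((1 + ‖X ω‖ ^ 2) / p (X ω) ^ q)) with hg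
  -- The index shift makes the domination hold for every `n`, as the reverse Fatou lemma below
  -- requires.
  have hbound : ∀ n, F (n + 2 * n₀) ≤ᵐ[P] g := by
    intro n
    filter_upwards [hXU] with ω hω
    refine rpow_mul_nnSqDist_le_of_two_mul_le hd (mul_pos hκ0 hv0) (h.pos _ hω) hrκ ?_
      (by omega) (by omega : 2 * n₀ ≤ n + 2 * n₀) (hmoment _)
    intro r hr0 hr
    refine le_trans (le_of_eq ?_) (hmass _ hω r hr0 hr)
    ring
  have hgfin : ∫⁻ ω, g ω ∂P ≠ ∞ := (hint.const_mul K).lintegral_lt_top.ne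
  have hpt : ∀ᵐ ω ∂P, limsup (fun n => F (n + 2 * n₀) ω) atTop
      ≤ ENNReal.ofReal ((v / 2) ^ (-q) * Real.Gamma (q + 1) * (1 / p (X ω) ^ q)) := by
    filter_upwards [hXU] with ω hω
    rw [limsup_nat_add (fun n => F n ω)]
    obtain ⟨δ, hδ, hloc⟩ := h.exists_local_mass hω
    exact limsup_rpow_mul_nnSqDist_le hd (by positivity) (h.pos _ hω) hδ hloc
      (ne_top_of_le_ne_top ENNReal.ofReal_ne_top (hmoment _))
  have hint1 : Integrable (fun ω => 1 / p (X ω) ^ q) P := by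
    refine hint.mono ?_ ?_
    -- No measurability of `p` is assumed: that of `1 / p (X ω) ^ q` is recovered by dividing the
    -- integrable function by `1 + ‖X ω‖ ^ 2`.
    · have h1 : AEStronglyMeasurable (fun ω => (1 + ‖X ω‖ ^ 2)⁻¹) P :=
        ((hX.norm.pow_const 2).const_add 1).inv.aestronglyMeasurable
      refine (h1.mul hint.aestronglyMeasurable).congr (ae_of_all _ fun ω => ?_)
      have : (1 : ℝ) + ‖X ω‖ ^ 2 ≠ 0 := by positivity
      simp only [Pi.mul_apply]
      field_simp
    · refine ae_of_all _ fun ω => ?_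
      rw [norm_div, norm_div, norm_one, Real.norm_of_nonneg (by positivity : 0 ≤ 1 + ‖X ω‖ ^ 2)]
      gcongr
      nlinarith [sq_nonneg ‖X ω‖]
  simp_rw [hFint]
  rw [← limsup_nat_add _ (2 * n₀)]
  calc _ ≤ ∫⁻ ω, limsup (fun n => F (n + 2 * n₀) ω) atTop ∂P :=
        limsup_lintegral_le g (fun n => hFm _) hbound hgfin
    _ ≤ ∫⁻ ω, ENNReal.ofReal ((v / 2) ^ (-q) * Real.Gamma (q + 1) * (1 / p (X ω) ^ q)) ∂P :=
        lintegral_mono_ae hpt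
    _ = _ := by
        rw [← ofReal_integral_eq_lintegral_ofReal (hint1.const_mul _), integral_const_mul]
        filter_upwards [hXU] with ω hω
        have := h.pos _ hω
        simp only [Pi.zero_apply]
        positivity

end

/-! ### The main theorem -/

lemma ENNReal.limsup_add_le_of_limsup_le {u w : ℕ → ℝ≥0∞} {a b : ℝ≥0∞}
    (ha : a ≠ ∞) (hb : b ≠ ∞) (hu : limsup u atTop ≤ a) (hw : limsup w atTop ≤ b) :
    limsup (fun n => u n + w n) atTop ≤ a + b := by
  refine ENNReal.le_of_forall_pos_le_add fun ε hε _ => ?_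
  have hε2 : (ε / 2 : ℝ≥0∞) ≠ 0 := by simpa using hε.ne'
  have h1 := eventually_lt_of_limsup_lt (hu.trans_lt (ENNReal.lt_add_right ha hε2))
  have h2 := eventually_lt_of_limsup_lt (hw.trans_lt (ENNReal.lt_add_right hb hε2))
  refine limsup_le_of_le (by isBoundedDefault) ?_
  filter_upwards [h1, h2] with n h1 h2
  calc u n + w n ≤ (a + ε / 2) + (b + ε / 2) := add_le_add h1.le h2.le
    _ = a + b + (ε / 2 + ε / 2) := by ring
    _ = a + b + ε := by rw [ENNReal.add_halves]

lemma eventually_two_mul_rpow_le (d : ℕ) (hd : 1 ≤ d) :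
    ∀ᶠ m : ℕ in atTop, 2 * (m : ℝ) ^ (2 / ((d : ℝ) + 2)) ≤ m := by
  have hd0 : (1 : ℝ) ≤ d := by exact_mod_cast hd
  have h := ((tendsto_rpow_atTop (y := (d : ℝ) / (d + 2)) (by positivity)).comp
    tendsto_natCast_atTop_atTop).eventually_ge_atTop 2
  filter_upwards [h, eventually_ge_atTop 1] with m hm hm1
  have hm0 : (0 : ℝ) < m := by exact_mod_cast hm1
  simp only [Function.comp_apply] at hm
  calc 2 * (m : ℝ) ^ (2 / ((d : ℝ) + 2))
      ≤ (m : ℝ) ^ ((d : ℝ) / (d + 2)) * (m : ℝ) ^ (2 / ((d : ℝ) + 2)) := by gcongr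
    _ = m := by
      rw [← Real.rpow_add hm0, ← add_div, div_self (by positivity), Real.rpow_one]

/-- The factor `4` is `2 * 2`: eventually `k m < 2 m^(2/(d+2))`, and rounding down a quotient that
is at least `1` loses at most a factor `2`. -/
lemma eventually_rpow_le_mul_natCast_div {d : ℕ} (hd : 1 ≤ d) {k : ℕ → ℕ}
    (hk1 : ∀ m, 1 ≤ m → 1 ≤ k m)
    (hk : (fun m => (k m : ℝ)) ~[atTop] fun m : ℕ => (m : ℝ) ^ (2 / ((d : ℝ) + 2))) :
    ∀ᶠ m : ℕ in atTop, 1 ≤ k m ∧ k m ≤ m ∧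
      (m : ℝ) ^ ((d : ℝ) / (d + 2)) ≤ 4 * ((m / k m : ℕ) : ℝ) := by
  have hd0 : (1 : ℝ) ≤ d := by exact_mod_cast hd
  have hne : ∀ᶠ m : ℕ in atTop, (m : ℝ) ^ (2 / ((d : ℝ) + 2)) ≠ 0 := by
    filter_upwards [eventually_ge_atTop 1] with m hm
    have : (0 : ℝ) < m := by exact_mod_cast hm
    positivity
  have hlim := (isEquivalent_iff_tendsto_one hne).1 hk
  filter_upwards [hlim.eventually_lt_const (by norm_num : (1 : ℝ) < 2),
    eventually_two_mul_rpow_le d hd, eventually_ge_atTop 1] with m h1 h2 h3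
  have hm0 : (0 : ℝ) < m := by exact_mod_cast h3
  simp only [Pi.div_apply] at h1
  rw [div_lt_iff₀ (by positivity)] at h1
  have hkm : k m ≤ m := by exact_mod_cast (h1.le.trans h2)
  have hk0 : (0 : ℝ) < k m := by exact_mod_cast hk1 m h3
  refine ⟨hk1 m h3, hkm, ?_⟩
  have hn1 : 1 ≤ m / k m := Nat.div_pos hkm (hk1 m h3)
  have hlt : m < k m * (m / k m) + k m := by
    have := Nat.div_add_mod m (k m)
    have := Nat.mod_lt m (hk1 m h3)
    omega
  have hle : (m : ℝ) ≤ 2 * (k m * ((m / k m : ℕ) : ℝ)) := by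
    have h4 : k m ≤ k m * (m / k m) := Nat.le_mul_of_pos_right _ hn1
    have : m ≤ 2 * (k m * (m / k m)) := by omega
    exact_mod_cast this
  have hn0 : (0 : ℝ) < (m / k m : ℕ) := by exact_mod_cast hn1
  have hsplit : (m : ℝ) ^ ((d : ℝ) / (d + 2)) * (m : ℝ) ^ (2 / ((d : ℝ) + 2)) = m := by
    rw [← Real.rpow_add hm0, ← add_div, div_self (by positivity), Real.rpow_one]
  have hp : 0 < (m : ℝ) ^ (2 / ((d : ℝ) + 2)) := by positivity
  refine le_of_mul_le_mul_right ?_ hp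
  rw [hsplit]
  calc (m : ℝ) ≤ 2 * (k m * ((m / k m : ℕ) : ℝ)) := hle
    _ ≤ 2 * ((2 * (m : ℝ) ^ (2 / ((d : ℝ) + 2))) * ((m / k m : ℕ) : ℝ)) := by gcongr
    _ = _ := by ring

lemma tendsto_rpow_mul_div_sqrt {d : ℕ} {k : ℕ → ℕ} (σ : ℝ)
    (hk : (fun m => (k m : ℝ)) ~[atTop] fun m : ℕ => (m : ℝ) ^ (2 / ((d : ℝ) + 2))) :
    Tendsto (fun m : ℕ => (m : ℝ) ^ (1 / ((d : ℝ) + 2)) * (σ / √(k m))) atTop (𝓝 σ) := by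
  have hne : ∀ᶠ m : ℕ in atTop, (m : ℝ) ^ (2 / ((d : ℝ) + 2)) ≠ 0 := by
    filter_upwards [eventually_ge_atTop 1] with m hm
    have : (0 : ℝ) < m := by exact_mod_cast hm
    positivity
  have hlim := (((isEquivalent_iff_tendsto_one hne).1 hk).inv₀ one_ne_zero).sqrt.const_mul σ
  simp only [inv_one, Real.sqrt_one, mul_one] at hlim
  refine hlim.congr fun m => ?_
  simp only [Pi.div_apply]
  have : √((m : ℝ) ^ (2 / ((d : ℝ) + 2))) = (m : ℝ) ^ (1 / ((d : ℝ) + 2)) := by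
    rw [Real.sqrt_eq_rpow, ← Real.rpow_mul (Nat.cast_nonneg m)]
    congr 1
    ring
  rw [inv_div, Real.sqrt_div (by positivity), this]
  ring

theorem mainTheorem11 {E : Type*} [NormedAddCommGroup E] [NormedSpace ℝ E]
    [FiniteDimensional ℝ E] [MeasurableSpace E] [BorelSpace E] (d : ℕ) (hd : 1 ≤ d)
    (hdim : Module.finrank ℝ E = d) (vol : Measure E) [vol.IsAddHaarMeasure] (L : ℝ≥0) :
    ∃ C : ℝ, 0 ≤ C ∧
      ∀ (Ω : Type*) [MeasurableSpace Ω] (P : Measure Ω) [IsProbabilityMeasure P]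
        (T : Type*) [MeasurableSpace T]
        (μ μ' : Measure E) [IsProbabilityMeasure μ] [IsProbabilityMeasure μ']
        (ν : Measure T) [IsProbabilityMeasure ν]
        (X : Ω → E) (X' : ℕ → Ω → E) (Θ : ℕ → Ω → T),
        CovariateShiftModel P μ μ' ν X X' Θ →
        (∃ m₀ : ℕ, 1 ≤ m₀ ∧ Integrable (fun ω => ⨅ j : Fin m₀, ‖X' j ω‖) P) →
        ∀ (U : Set E) (p : E → ℝ), StrongSupport vol μ μ' U p →
        Integrable (fun ω => (1 + ‖X ω‖ ^ 2) / p (X ω) ^ (2 / (d : ℝ))) P →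
        ∀ f : E → T → ℝ, Measurable (Function.uncurry f) →
        (∀ θ, LipschitzWith L (fun x => f x θ)) →
        ∀ σ : ℝ, 0 ≤ σ →
        (∀ x ∈ μ'.support, MemLp (f x) 2 ν ∧ Var[f x; ν] ≤ σ ^ 2) →
        ∀ k : ℕ → ℕ, (∀ m, 1 ≤ m → 1 ≤ k m) → MonotoneOn k (Set.Ici 1) →
        (fun m => (k m : ℝ)) ~[atTop] (fun m : ℕ => (m : ℝ) ^ (2 / ((d : ℝ) + 2))) →
        limsup (fun m : ℕ => ENNReal.ofReal ((m : ℝ) ^ (1 / ((d : ℝ) + 2)))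
            * l2GeneralizationError P f ν X X' Θ m (k m)) atTop
          ≤ ENNReal.ofReal
              (σ + C * (∫ ω, 1 / p (X ω) ^ (2 / (d : ℝ)) ∂P) ^ (1 / 2 : ℝ)) := by
  have : ProperSpace E := FiniteDimensional.proper ℝ E
  have hd0 : (0 : ℝ) < d := by exact_mod_cast hd
  set q := 2 / (d : ℝ) with hq
  have hq0 : 0 < q := by positivity
  have hG : 0 < Real.Gamma (q + 1) := Real.Gamma_pos_of_pos (by positivity)
  set C₀ := (vol.real (Metric.closedBall 0 1) / 2) ^ (-q) * Real.Gamma (q + 1) with hC₀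
  have hC₀0 : 0 ≤ C₀ := by positivity
  -- `C₀` is the nearest-neighbor constant and `4 ^ q` is the cost of comparing `m^(d/(d+2))` with
  -- the block size. Neither depends on the laws.
  refine ⟨(4 ^ q * (L : ℝ) ^ 2 * C₀) ^ (1 / 2 : ℝ), by positivity, ?_⟩
  intro Ω _ P _ T _ μ μ' _ _ ν _ X X' Θ hmodel ⟨m₀, hm₀, hmin⟩ U p hsupp hint f hfm hf σ hσ hvar k
    hk1 _ hk
  set I := ∫ ω, 1 / p (X ω) ^ q ∂P with hI
  have hI0 : 0 ≤ I := by
    refine integral_nonneg_of_ae ?_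
    have h1 : ∀ᵐ x ∂μ, x ∈ U := by
      filter_upwards [Measure.support_mem_ae (μ := μ)] with x hx using hsupp.support_subset hx
    rw [← hmodel.law_X] at h1
    filter_upwards [ae_of_ae_map hmodel.measurable_X.aemeasurable h1] with ω hω
    have := hsupp.pos _ hω
    simp only [Pi.zero_apply]
    positivity
  have hindX' : iIndepFun X' P :=
    hmodel.indep_sample.comp (fun _ => Prod.fst) fun _ => measurable_fst
  set J : ℕ → ℝ≥0∞ :=
    fun n => ENNReal.ofReal ((n : ℝ) ^ q) * ∫⁻ ω, nnSqDist μ' n (X ω) ∂P with hJ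
  have hlimJ : limsup J atTop ≤ ENNReal.ofReal (C₀ * I) :=
    limsup_lintegral_nnSqDist_le hd hdim hmodel.measurable_X hmodel.law_X hsupp
      (n₀ := 2 * m₀) (by omega)
      (nnSqDist_two_mul_le hmodel.measurable_X' hindX' hmodel.law_X' hm₀ hmin) hint
  have hev := eventually_rpow_le_mul_natCast_div hd hk1 hk
  have hn : Tendsto (fun m => m / k m) atTop atTop := by
    rw [← tendsto_natCast_atTop_iff (R := ℝ)]
    have h1 := ((tendsto_rpow_atTop (y := (d : ℝ) / (d + 2)) (by positivity)).comp
      tendsto_natCast_atTop_atTop).atTop_div_const (by norm_num : (0 : ℝ) < 4)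
    refine tendsto_atTop_mono' _ ?_ h1
    filter_upwards [hev] with m hm
    simp only [Function.comp_apply]
    linarith [hm.2.2]
  -- The block size tends to infinity, so the limsup along it is at most the full limsup.
  have hlimJk : limsup (fun m => J (m / k m)) atTop ≤ ENNReal.ofReal (C₀ * I) :=
    (limsup_le_limsup_of_le (f := map (fun m => m / k m) atTop) (u := J) hn).trans hlimJ
  have hhalf : (0 : ℝ) < 1 / 2 := by norm_num
  have hbias : limsup (fun m => (ENNReal.ofReal (4 ^ q * (L : ℝ) ^ 2) * J (m / k m)) ^ (1 / 2 : ℝ))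
      atTop ≤ ENNReal.ofReal ((4 ^ q * (L : ℝ) ^ 2 * C₀) ^ (1 / 2 : ℝ) * I ^ (1 / 2 : ℝ)) := by
    have h1 := OrderIso.limsup_apply (f := atTop) (ENNReal.orderIsoRpow (1 / 2) hhalf)
      (u := fun m => ENNReal.ofReal (4 ^ q * (L : ℝ) ^ 2) * J (m / k m))
    simp only [ENNReal.orderIsoRpow_apply] at h1
    rw [← h1, ENNReal.limsup_const_mul_of_ne_top ENNReal.ofReal_ne_top,
      ← Real.mul_rpow (by positivity) hI0, ← ENNReal.ofReal_rpow_of_nonneg (by positivity) hhalf.le,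
      mul_assoc _ C₀, ENNReal.ofReal_mul (p := 4 ^ q * (L : ℝ) ^ 2) (by positivity)]
    gcongr
  have hvarlim : limsup (fun m : ℕ =>
      ENNReal.ofReal ((m : ℝ) ^ (1 / ((d : ℝ) + 2)) * (σ / √(k m)))) atTop ≤ ENNReal.ofReal σ :=
    (ENNReal.tendsto_ofReal (tendsto_rpow_mul_div_sqrt σ hk)).limsup_eq.le
  rw [ENNReal.ofReal_add hσ (by positivity)]
  refine le_trans (limsup_le_limsup ?_) (ENNReal.limsup_add_le_of_limsup_le ENNReal.ofReal_ne_top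
    ENNReal.ofReal_ne_top hvarlim hbias)
  filter_upwards [hev] with m ⟨hkm1, hkm, hmn⟩
  set n := m / k m with hndef
  have hk0 : (0 : ℝ) < k m := by exact_mod_cast hkm1
  calc _ ≤ ENNReal.ofReal ((m : ℝ) ^ (1 / ((d : ℝ) + 2)))
        * ((ENNReal.ofReal (σ ^ 2 / k m)) ^ (1 / 2 : ℝ)
          + (ENNReal.ofReal ((L : ℝ) ^ 2) * ∫⁻ ω, nnSqDist μ' n (X ω) ∂P) ^ (1 / 2 : ℝ)) := by
        gcongr
        -- Subadditivity of the square root separates noise from bias, leaving coefficient one in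
        -- front of `σ`.
        exact (l2GeneralizationError_le hmodel hfm hf hvar hkm1 hkm).trans
          (ENNReal.rpow_add_le_add_rpow _ _ hhalf.le (by norm_num))
    _ ≤ _ := by
        rw [mul_add]
        refine add_le_add (le_of_eq ?_) ?_
        · rw [ENNReal.ofReal_rpow_of_nonneg (by positivity) hhalf.le,
            ← ENNReal.ofReal_mul (by positivity), ← Real.sqrt_eq_rpow,
            Real.sqrt_div (sq_nonneg σ), Real.sqrt_sq hσ]
        -- Raise `m^(d/(d+2)) ≤ 4 n` to the power `q / 2 = 1 / d`.
        · have hm : ENNReal.ofReal ((m : ℝ) ^ (1 / ((d : ℝ) + 2)))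
              ≤ (ENNReal.ofReal (4 ^ q * (n : ℝ) ^ q)) ^ (1 / 2 : ℝ) := by
            rw [ENNReal.ofReal_rpow_of_nonneg (by positivity) hhalf.le]
            refine ENNReal.ofReal_le_ofReal ?_
            rw [← Real.mul_rpow (by norm_num) (Nat.cast_nonneg n),
              ← Real.rpow_mul (by positivity)]
            calc (m : ℝ) ^ (1 / ((d : ℝ) + 2))
                = ((m : ℝ) ^ ((d : ℝ) / (d + 2))) ^ (q * (1 / 2)) := by
                  rw [← Real.rpow_mul (Nat.cast_nonneg m)]
                  congr 1
                  rw [hq]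
                  field_simp
              _ ≤ _ := by gcongr
          refine (mul_le_mul_left hm _).trans (le_of_eq ?_)
          rw [← ENNReal.mul_rpow_of_nonneg _ _ hhalf.le]
          congr 1
          rw [hJ]
          simp only
          rw [ENNReal.ofReal_mul (by positivity), ENNReal.ofReal_mul (by positivity)]
          ring
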